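/- For $x>0$ put $$\phi(x)=1-\frac1{\sqrt{4\pi x}}\int_{\mathbb R}\tanh\frac u2\;e^{-(u-x)^2/(4x)}\,du ,\qquad \phi(0)=1,$$ and let $\phi^{-1}$ denote the inverse of $\phi$ on $[0,\infty)$. Let $d_v\ge 3$ and $d_c\ge 2$ be the variable and check degrees of a $(d_v,d_c)$-regular LDPC code of rate $R>0$, used on the binary-input AWGN channel at signal-to-noise ratio $E_b/N_0$, so that the mean channel log-likelihood ratio is $m_\lambda=4R\,E_b/N_0$. Let $m^{(l)}$ be the check node output mean after $l$ iterations given by consistent Gaussian-approximation density evolution: $m^{(0)}=0$ and $$m^{(l)}=\phi^{-1}\Bigl(1-\bigl[1-\phi\bigl(m_\lambda+(d_v-1)m^{(l-1)}\bigr)\bigr]^{d_c-1}\Bigr),\qquad l\ge1 .$$ Then: (1) At sufficiently high $E_b/N_0$ the means grow at least like $(d_v-1)^l$ after finitely many iterations: there is $T$ (depending on $d_v,d_c,R$) such that for every $E_b/N_0>T$ there are $C>0$ and $L$ with $m^{(l)}>C(d_v-1)^l$ for all $l\ge L$. (2) An explicit sufficient condition is the following. If at some iteration $l_0$ one has $m^{(l_0)}>3$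 and $$R\,\frac{E_b}{N_0}>\ln\frac{d_c-1}{\delta},\qquad \delta=1-\frac{3}{m^{(l_0)}},$$ then $m^{(l)}>(d_v-1)\,m^{(l-1)}$ for all $l\ge l_0$, and there is $C>0$ with $m^{(l)}>C(d_v-1)^l$ for all $l\ge l_0$. (3) If $R\,E_b/N_0>\ln(d_c-1)$, then the condition in (2) is satisfied at every iteration $l_0$ from some iteration on. -/

import Mathlib

namespace GaussianDE

/-- The function `φ` of the consistent Gaussian approximation:
`φ x = 1 - E[tanh (u / 2)]` for `u` Gaussian of mean `x` and variance `2 x`, and `φ 0 = 1`.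
Only its values on `[0, ∞)` are meaningful. -/
noncomputable def phi (x : ℝ) : ℝ :=
  if 0 < x then
    1 - 1 / Real.sqrt (4 * Real.pi * x) *
      ∫ u : ℝ, Real.tanh (u / 2) * Real.exp (-(u - x) ^ 2 / (4 * x))
  else 1

/-- The inverse of `φ` as a function on `[0, ∞)`. -/
noncomputable def phiInv (y : ℝ) : ℝ :=
  Function.invFunOn phi (Set.Ici 0) y

/-- Mean of the channel log-likelihood ratios of the binary-input AWGN channel at code rate `R` and
signal-to-noise ratio `E_b / N_0 = snr` (a linear ratio, not in dB). -/
noncomputable def channelMean (R snr : ℝ) : ℝ := 4 * R * snr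

/-- The check node output mean after `l` iterations, for variable degree `dv`, check degree `dc` and
channel mean `mch`. Before the first iteration the check nodes have sent nothing, so the variable
node messages entering the first iteration have mean `mch`. -/
noncomputable def checkMean (dv dc : ℕ) (mch : ℝ) : ℕ → ℝ
  | 0 => 0
  | l + 1 =>
      phiInv (1 - (1 - phi (mch + ((dv : ℝ) - 1) * checkMean dv dc mch l)) ^ (dc - 1))

/-- The quantity `δ = 1 - 3 / m` attached to a check node output mean `m`. -/
noncomputable def delta (m : ℝ) : ℝ := 1 - 3 / m

end GaussianDE

open MeasureTheory Set Filter Topology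

namespace GaussianDE

/-! Completing the square gives φ(x) = e^{-x/4} E[sech(√x v)] with a Gaussian v whose law does not
depend on x. The expectation decreases in x, so φ(y + a) ≤ e^{-a/4} φ(y) (`phi_add_le`). Bernoulli's
inequality gives 1 - (1 - p)^(dc-1) ≤ (dc-1) p. With p = φ(a + y), the argument of φ⁻¹ is therefore
below φ(y) once (dc-1) e^{-a/4} < 1, and the check update exceeds y = (dv-1) m
(`lt_phiInv_checkUpdate`). As a/4 = R E_b/N_0, this is the threshold ln(dc-1), valid at every
iteration. Condition (2) implies it, and for (3) the means diverge, so δ → 1. -/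

/-- The Gaussian average of `sech (√x v)`, without the normalising factor `1 / √π`. -/
noncomputable def sechIntegral (x : ℝ) : ℝ :=
  ∫ v : ℝ, Real.exp (-v ^ 2) / Real.cosh (Real.sqrt x * v)

lemma integrable_exp_neg_sq : Integrable fun v : ℝ => Real.exp (-v ^ 2) := by
  simpa using integrable_exp_neg_mul_sq (b := 1) one_pos

lemma integral_exp_neg_sq : ∫ v : ℝ, Real.exp (-v ^ 2) = Real.sqrt Real.pi := by
  simpa using integral_gaussian 1

lemma continuous_exp_neg_sq_div_cosh (s : ℝ) :
    Continuous fun v : ℝ => Real.exp (-v ^ 2) / Real.cosh (s * v) :=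
  Continuous.div (by fun_prop) (Real.continuous_cosh.comp (by fun_prop))
    fun v => (Real.cosh_pos _).ne'

lemma norm_exp_neg_sq_div_cosh_le (s v : ℝ) :
    ‖Real.exp (-v ^ 2) / Real.cosh (s * v)‖ ≤ Real.exp (-v ^ 2) := by
  rw [Real.norm_of_nonneg (div_nonneg (Real.exp_pos _).le (Real.cosh_pos _).le)]
  exact div_le_self (Real.exp_pos _).le (Real.one_le_cosh _)

lemma integrable_exp_neg_sq_div_cosh (s : ℝ) :
    Integrable fun v : ℝ => Real.exp (-v ^ 2) / Real.cosh (s * v) :=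
  integrable_exp_neg_sq.mono' (continuous_exp_neg_sq_div_cosh s).aestronglyMeasurable
    (ae_of_all _ (norm_exp_neg_sq_div_cosh_le s))

lemma sechIntegral_zero : sechIntegral 0 = Real.sqrt Real.pi := by
  simp [sechIntegral, integral_exp_neg_sq]

lemma sechIntegral_pos (x : ℝ) : 0 < sechIntegral x := by
  refine integral_pos_of_integrable_nonneg_nonzero (x := 0)
    (continuous_exp_neg_sq_div_cosh _) (integrable_exp_neg_sq_div_cosh _)
    (fun v => div_nonneg (Real.exp_pos _).le (Real.cosh_pos _).le) (by simp)

lemma sechIntegral_antitone : Antitone sechIntegral := by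
  intro x y hxy
  refine integral_mono (integrable_exp_neg_sq_div_cosh _) (integrable_exp_neg_sq_div_cosh _) ?_
  intro v
  refine div_le_div_of_nonneg_left (Real.exp_pos _).le (Real.cosh_pos _) ?_
  rw [Real.cosh_le_cosh, abs_mul, abs_mul, abs_of_nonneg (Real.sqrt_nonneg x),
    abs_of_nonneg (Real.sqrt_nonneg y)]
  exact mul_le_mul_of_nonneg_right (Real.sqrt_le_sqrt hxy) (abs_nonneg v)

lemma continuous_sechIntegral : Continuous sechIntegral := by
  refine continuous_of_dominated
    (fun x => (continuous_exp_neg_sq_div_cosh _).aestronglyMeasurable)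
    (fun x => ae_of_all _ (norm_exp_neg_sq_div_cosh_le _)) integrable_exp_neg_sq
    (ae_of_all _ fun v => ?_)
  exact continuous_const.div (Real.continuous_cosh.comp (by fun_prop))
    fun x => (Real.cosh_pos _).ne'

lemma one_sub_tanh (w : ℝ) : 1 - Real.tanh w = Real.exp (-w) / Real.cosh w := by
  rw [Real.tanh_eq_sinh_div_cosh, ← Real.cosh_sub_sinh, sub_div, div_self (Real.cosh_pos w).ne']

/-- Completing the square and rescaling turns `φ` into `e^{-x/4} E[sech (√x v)]`. -/
lemma phi_eq {x : ℝ} (hx : 0 ≤ x) :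
    phi x = Real.exp (-x / 4) * (sechIntegral x / Real.sqrt Real.pi) := by
  have hpi : Real.sqrt Real.pi ≠ 0 := (Real.sqrt_pos.2 Real.pi_pos).ne'
  rcases hx.eq_or_lt with rfl | hx
  · simp [phi, sechIntegral_zero, div_self hpi]
  obtain ⟨s, hs, rfl⟩ : ∃ s : ℝ, 0 < s ∧ x = s ^ 2 :=
    ⟨Real.sqrt x, Real.sqrt_pos.2 hx, (Real.sq_sqrt hx.le).symm⟩
  have hsub : ∫ u : ℝ, Real.tanh (u / 2) * Real.exp (-(u - s ^ 2) ^ 2 / (4 * s ^ 2)) =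
      (2 * s) * ∫ v : ℝ, Real.tanh (s * v) * Real.exp (-(v - s / 2) ^ 2) := by
    have h := Measure.integral_comp_mul_left
      (fun u : ℝ => Real.tanh (u / 2) * Real.exp (-(u - s ^ 2) ^ 2 / (4 * s ^ 2))) (2 * s)
    rw [abs_of_pos (by positivity), smul_eq_mul, eq_inv_mul_iff_mul_eq₀ (by positivity)] at h
    rw [← h]
    -- Under u = 2sv the exponent becomes -(v - s/2)².
    congr 2
    ext v
    congr 2
    · ring
    · field_simp
      ring
  have hshift : Integrable fun v : ℝ => Real.exp (-(v - s / 2) ^ 2) :=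
    integrable_exp_neg_sq.comp_sub_right (s / 2)
  have hone : ∫ v : ℝ, Real.exp (-(v - s / 2) ^ 2) = Real.sqrt Real.pi := by
    rw [integral_sub_right_eq_self (fun v : ℝ => Real.exp (-v ^ 2)), integral_exp_neg_sq]
  have hpoint : ∀ v : ℝ, Real.tanh (s * v) * Real.exp (-(v - s / 2) ^ 2) =
      Real.exp (-(v - s / 2) ^ 2) -
        Real.exp (-s ^ 2 / 4) * (Real.exp (-v ^ 2) / Real.cosh (s * v)) := by
    intro v
    have he : Real.exp (-s ^ 2 / 4) * Real.exp (-v ^ 2) =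
        Real.exp (-(s * v)) * Real.exp (-(v - s / 2) ^ 2) := by
      rw [← Real.exp_add, ← Real.exp_add]
      congr 1
      ring
    rw [← mul_div_assoc, he, mul_div_right_comm, ← one_sub_tanh]
    ring
  have hint : ∫ v : ℝ, Real.tanh (s * v) * Real.exp (-(v - s / 2) ^ 2) =
      Real.sqrt Real.pi - Real.exp (-s ^ 2 / 4) * sechIntegral (s ^ 2) := by
    simp_rw [hpoint]
    rw [integral_sub hshift ((integrable_exp_neg_sq_div_cosh s).const_mul _), hone,
      integral_const_mul, sechIntegral, Real.sqrt_sq hs.le]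
  have hroot : Real.sqrt (4 * Real.pi * s ^ 2) = 2 * s * Real.sqrt Real.pi := by
    rw [show 4 * Real.pi * s ^ 2 = (2 * s) ^ 2 * Real.pi by ring, Real.sqrt_mul (by positivity),
      Real.sqrt_sq (by positivity)]
  rw [phi, if_pos hx, hsub, hint, hroot]
  field_simp
  ring

lemma phi_zero : phi 0 = 1 := by simp [phi]

lemma phi_pos {x : ℝ} (hx : 0 ≤ x) : 0 < phi x := by
  rw [phi_eq hx]
  have := sechIntegral_pos x
  have := Real.sqrt_pos.2 Real.pi_pos
  positivity

lemma phi_add_le {x a : ℝ} (hx : 0 ≤ x) (ha : 0 ≤ a) :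
    phi (x + a) ≤ Real.exp (-a / 4) * phi x := by
  rw [phi_eq hx, phi_eq (add_nonneg hx ha), ← mul_assoc, ← Real.exp_add,
    show -(x + a) / 4 = -a / 4 + -x / 4 by ring]
  have := sechIntegral_antitone (le_add_of_nonneg_right ha : x ≤ x + a)
  gcongr

lemma phi_le_exp {x : ℝ} (hx : 0 ≤ x) : phi x ≤ Real.exp (-x / 4) := by
  simpa [phi_zero] using phi_add_le le_rfl hx

lemma phi_antitoneOn : AntitoneOn phi (Ici 0) := by
  intro x hx y hy hxy
  have h := phi_add_le hx (sub_nonneg.2 hxy)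
  rw [add_sub_cancel] at h
  refine h.trans (mul_le_of_le_one_left (phi_pos hx).le ?_)
  rw [Real.exp_le_one_iff]
  linarith

lemma continuousOn_phi : ContinuousOn phi (Ici 0) := by
  refine ContinuousOn.congr (f := fun x =>
    Real.exp (-x / 4) * (sechIntegral x / Real.sqrt Real.pi)) ?_ fun x hx => phi_eq hx
  have := continuous_sechIntegral
  fun_prop

lemma exists_phi_eq {y : ℝ} (hy : 0 < y) (hy1 : y ≤ 1) : ∃ x ∈ Ici (0 : ℝ), phi x = y := by
  have hb : 0 ≤ -(4 * Real.log y) := by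
    have := Real.log_nonpos hy.le hy1
    linarith
  have hle : phi (-(4 * Real.log y)) ≤ y := by
    refine (phi_le_exp hb).trans_eq ?_
    rw [show -(-(4 * Real.log y)) / 4 = Real.log y by ring, Real.exp_log hy]
  obtain ⟨x, hx, hxy⟩ := intermediate_value_Icc' hb (continuousOn_phi.mono Icc_subset_Ici_self)
    ⟨hle, hy1.trans_eq phi_zero.symm⟩
  exact ⟨x, hx.1, hxy⟩

lemma phiInv_nonneg {y : ℝ} (hy : 0 < y) (hy1 : y ≤ 1) : 0 ≤ phiInv y :=
  Function.invFunOn_mem (exists_phi_eq hy hy1)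

lemma phi_phiInv {y : ℝ} (hy : 0 < y) (hy1 : y ≤ 1) : phi (phiInv y) = y :=
  Function.invFunOn_eq (exists_phi_eq hy hy1)

/-- Weak monotonicity of φ is enough: any preimage of y that is at most x would force φ(x) ≤ y. -/
lemma lt_phiInv {x y : ℝ} (hx : 0 ≤ x) (hy : 0 < y) (hxy : y < phi x) : x < phiInv y := by
  have hy1 : y ≤ 1 :=
    hxy.le.trans ((phi_antitoneOn (mem_Ici.2 le_rfl) hx hx).trans_eq phi_zero)
  by_contra! h
  have := phi_antitoneOn (phiInv_nonneg hy hy1) hx h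
  rw [phi_phiInv hy hy1] at this
  exact this.not_gt hxy

/-- One check node update increases the mean of the non-channel part `y` of the incoming
messages, as soon as `e^{-a/4} (dc - 1) < 1` for the channel mean `a`. -/
lemma lt_phiInv_checkUpdate {dc : ℕ} (hdc : 2 ≤ dc) {a y : ℝ} (ha : 0 ≤ a) (hy : 0 ≤ y)
    (h : Real.log ((dc : ℝ) - 1) < a / 4) :
    y < phiInv (1 - (1 - phi (a + y)) ^ (dc - 1)) := by
  have hdc' : (2 : ℝ) ≤ dc := by exact_mod_cast hdc
  have hay : 0 ≤ a + y := add_nonneg ha hy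
  have hp := phi_pos hay
  have hp1 : phi (a + y) ≤ 1 :=
    (phi_antitoneOn (mem_Ici.2 le_rfl) hay hay).trans_eq phi_zero
  -- Keeps the argument of `phiInv` positive, so that a preimage exists.
  have hpow : (1 - phi (a + y)) ^ (dc - 1) < 1 :=
    pow_lt_one₀ (by linarith) (by linarith) (by omega)
  refine lt_phiInv hy (by linarith) ?_
  have hbern := one_add_mul_le_pow (a := -phi (a + y)) (by linarith) (dc - 1)
  rw [Nat.cast_sub (by omega), Nat.cast_one, ← sub_eq_add_neg] at hbern
  have hdecay : phi (a + y) ≤ Real.exp (-a / 4) * phi y := by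
    rw [add_comm]
    exact phi_add_le hy ha
  have hexp : ((dc : ℝ) - 1) * Real.exp (-a / 4) < 1 := by
    rw [Real.log_lt_iff_lt_exp (by linarith)] at h
    rw [neg_div, Real.exp_neg, ← div_eq_mul_inv, div_lt_one (Real.exp_pos _)]
    exact h
  calc 1 - (1 - phi (a + y)) ^ (dc - 1)
      ≤ ((dc : ℝ) - 1) * phi (a + y) := by linarith
    _ ≤ ((dc : ℝ) - 1) * (Real.exp (-a / 4) * phi y) :=
        mul_le_mul_of_nonneg_left hdecay (by linarith)
    _ = ((dc : ℝ) - 1) * Real.exp (-a / 4) * phi y := by ring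
    _ < phi y := mul_lt_of_lt_one_left (phi_pos hy) hexp

section Growth

variable {dv dc : ℕ} {a : ℝ}

lemma channelMean_pos_of_log_lt (hdc : 2 ≤ dc) (h : Real.log ((dc : ℝ) - 1) < a / 4) : 0 < a := by
  have hdc' : (2 : ℝ) ≤ dc := by exact_mod_cast hdc
  have := Real.log_nonneg (show (1 : ℝ) ≤ (dc : ℝ) - 1 by linarith)
  linarith

lemma checkMean_nonneg (hdv : 3 ≤ dv) (hdc : 2 ≤ dc) (h : Real.log ((dc : ℝ) - 1) < a / 4) (l : ℕ) :
    0 ≤ checkMean dv dc a l := by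
  have hdv' : (3 : ℝ) ≤ dv := by exact_mod_cast hdv
  induction l with
  | zero => exact le_rfl
  | succ l ih =>
    have hy : 0 ≤ ((dv : ℝ) - 1) * checkMean dv dc a l := mul_nonneg (by linarith) ih
    exact hy.trans (lt_phiInv_checkUpdate hdc (channelMean_pos_of_log_lt hdc h).le hy h).le

lemma mul_checkMean_lt_succ (hdv : 3 ≤ dv) (hdc : 2 ≤ dc)
    (h : Real.log ((dc : ℝ) - 1) < a / 4) (l : ℕ) :
    ((dv : ℝ) - 1) * checkMean dv dc a l < checkMean dv dc a (l + 1) := by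
  have hdv' : (3 : ℝ) ≤ dv := by exact_mod_cast hdv
  exact lt_phiInv_checkUpdate hdc (channelMean_pos_of_log_lt hdc h).le
    (mul_nonneg (by linarith) (checkMean_nonneg hdv hdc h l)) h

lemma exists_mul_pow_lt_checkMean (hdv : 3 ≤ dv) (hdc : 2 ≤ dc)
    (h : Real.log ((dc : ℝ) - 1) < a / 4) :
    ∃ C : ℝ, 0 < C ∧ ∀ l : ℕ, 1 ≤ l → C * ((dv : ℝ) - 1) ^ l < checkMean dv dc a l := by
  have hdv' : (3 : ℝ) ≤ dv := by exact_mod_cast hdv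
  have hq : 0 < (dv : ℝ) - 1 := by linarith
  have h1 : 0 < checkMean dv dc a 1 := by
    simpa [checkMean] using mul_checkMean_lt_succ hdv hdc h 0
  -- The factor 2 makes the bound strict at l = 1; l = 0 is excluded because the initial mean is 0.
  refine ⟨checkMean dv dc a 1 / (2 * ((dv : ℝ) - 1)), by positivity, fun l hl => ?_⟩
  induction l, hl using Nat.le_induction with
  | base =>
    rw [pow_one, div_mul_eq_mul_div, div_lt_iff₀ (by positivity)]
    nlinarith [mul_pos h1 hq]
  | succ l hl ih =>
    refine lt_trans ?_ (mul_checkMean_lt_succ hdv hdc h l)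
    rw [pow_succ, ← mul_assoc, mul_comm]
    exact mul_lt_mul_of_pos_left ih hq

lemma tendsto_checkMean_atTop (hdv : 3 ≤ dv) (hdc : 2 ≤ dc)
    (h : Real.log ((dc : ℝ) - 1) < a / 4) :
    Tendsto (checkMean dv dc a) atTop atTop := by
  have hdv' : (3 : ℝ) ≤ dv := by exact_mod_cast hdv
  obtain ⟨C, hC, hlt⟩ := exists_mul_pow_lt_checkMean (a := a) hdv hdc h
  refine tendsto_atTop_mono' _ ?_
    ((tendsto_pow_atTop_atTop_of_one_lt (r := (dv : ℝ) - 1) (by linarith)).const_mul_atTop hC)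
  filter_upwards [eventually_ge_atTop 1] with l hl using (hlt l hl).le

end Growth

/-- For m > 3, 0 < δ ≤ 1, so dividing by δ only strengthens the condition. -/
lemma log_lt_of_log_div_delta_lt {b m t : ℝ} (hb : 0 < b) (hm : 3 < m)
    (h : Real.log (b / delta m) < t) : Real.log b < t := by
  have hm0 : 0 < m := by linarith
  have hδ : 0 < delta m := sub_pos.2 ((div_lt_one hm0).2 hm)
  have hδ1 : delta m ≤ 1 := sub_le_self _ (by positivity)
  refine lt_of_le_of_lt (Real.log_le_log hb ?_) h
  rw [le_div_iff₀ hδ]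
  exact mul_le_of_le_one_right hb.le hδ1

lemma tendsto_log_div_delta {b : ℝ} (hb : 0 < b) :
    Tendsto (fun m => Real.log (b / delta m)) atTop (𝓝 (Real.log b)) := by
  have hδ : Tendsto (fun m => delta m) atTop (𝓝 1) := by
    simpa [delta] using (tendsto_const_nhds (x := (1 : ℝ))).sub
      ((tendsto_const_nhds (x := (3 : ℝ))).div_atTop tendsto_id)
  have := (tendsto_const_nhds (x := b)).div hδ one_ne_zero
  rw [div_one] at this
  exact this.log hb.ne'

end GaussianDE

theorem theorem2 (dv dc : ℕ) (hdv : 3 ≤ dv) (hdc : 2 ≤ dc) (R : ℝ) (hR : 0 < R) :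
    -- exponential growth at sufficiently high `E_b / N_0`
    (∃ T : ℝ, ∀ snr : ℝ, T < snr →
      ∃ C : ℝ, 0 < C ∧ ∃ L : ℕ, ∀ l : ℕ, L ≤ l →
        C * ((dv : ℝ) - 1) ^ l
          < GaussianDE.checkMean dv dc (GaussianDE.channelMean R snr) l) ∧
    -- the explicit condition `R E_b / N_0 > ln ((d_c - 1) / δ)`, met at some iteration `l₀`
    (∀ (snr : ℝ) (l₀ : ℕ),
      3 < GaussianDE.checkMean dv dc (GaussianDE.channelMean R snr) l₀ →
      Real.log (((dc : ℝ) - 1) /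
          GaussianDE.delta (GaussianDE.checkMean dv dc (GaussianDE.channelMean R snr) l₀))
        < R * snr →
      (∀ l : ℕ, l₀ ≤ l + 1 →
        ((dv : ℝ) - 1) * GaussianDE.checkMean dv dc (GaussianDE.channelMean R snr) l
          < GaussianDE.checkMean dv dc (GaussianDE.channelMean R snr) (l + 1)) ∧
      ∃ C : ℝ, 0 < C ∧ ∀ l : ℕ, l₀ ≤ l →
        C * ((dv : ℝ) - 1) ^ l
          < GaussianDE.checkMean dv dc (GaussianDE.channelMean R snr) l) ∧
    -- for `R E_b / N_0 > ln (d_c - 1)` (the limit `δ → 1`) it is met from some iteration on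
    (∀ snr : ℝ, Real.log ((dc : ℝ) - 1) < R * snr →
      ∃ L : ℕ, ∀ l : ℕ, L ≤ l →
        3 < GaussianDE.checkMean dv dc (GaussianDE.channelMean R snr) l ∧
        Real.log (((dc : ℝ) - 1) /
            GaussianDE.delta (GaussianDE.checkMean dv dc (GaussianDE.channelMean R snr) l))
          < R * snr) := by
  have hdc' : (2 : ℝ) ≤ dc := by exact_mod_cast hdc
  have hb : (0 : ℝ) < (dc : ℝ) - 1 := by linarith
  have hmean : ∀ {snr : ℝ}, Real.log ((dc : ℝ) - 1) < R * snr →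
      Real.log ((dc : ℝ) - 1) < GaussianDE.channelMean R snr / 4 := by
    intro snr h
    rwa [GaussianDE.channelMean, show 4 * R * snr / 4 = R * snr by ring]
  refine ⟨⟨Real.log ((dc : ℝ) - 1) / R, fun snr hsnr => ?_⟩, fun snr l₀ hm hcond => ?_,
    fun snr hsnr => ?_⟩
  · rw [div_lt_iff₀' hR] at hsnr
    obtain ⟨C, hC, h⟩ := GaussianDE.exists_mul_pow_lt_checkMean hdv hdc (hmean hsnr)
    exact ⟨C, hC, 1, h⟩
  · have hlog := hmean (GaussianDE.log_lt_of_log_div_delta_lt hb hm hcond)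
    refine ⟨fun l _ => GaussianDE.mul_checkMean_lt_succ hdv hdc hlog l, ?_⟩
    -- The initial mean 0 cannot exceed 3.
    have hl₀ : 1 ≤ l₀ := by
      rcases Nat.eq_zero_or_pos l₀ with rfl | hpos
      · norm_num [GaussianDE.checkMean] at hm
      · exact hpos
    obtain ⟨C, hC, h⟩ := GaussianDE.exists_mul_pow_lt_checkMean hdv hdc hlog
    exact ⟨C, hC, fun l hl => h l (hl₀.trans hl)⟩
  · have ht := GaussianDE.tendsto_checkMean_atTop hdv hdc (hmean hsnr)
    exact eventually_atTop.1 ((ht.eventually_gt_atTop 3).and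
      (((GaussianDE.tendsto_log_div_delta hb).comp ht).eventually_lt_const hsnr))
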